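/- A \emph{finite relational signature} is a finite set of relation symbols, each with an arity; the largest arity of a signature without symbols is taken to be $0$. An \emph{embedding} of $\sigma$-structures is an injective map that preserves and reflects every relation. A \emph{hereditary class} of $\sigma$-structures is a class of finite $\sigma$-structures that is closed under embeddings (if $\mathbb A\in\mathcal C$ and $\mathbb B$ embeds in $\mathbb A$, then $\mathbb B\in\mathcal C$); it is regarded as a category whose morphisms are the embeddings. $\mathrm{Mod}_\sigma$ is the class of all finite $\sigma$-structures. A \emph{concrete functor} $F\colon\mathcal C\to\mathcal D$ is a functor with $F(f)=f$ for every embedding $f$; that is, $F(\mathbb A)\in\mathcal D$ has the same vertex set as $\mathbb A$ for every $\mathbb A\in\mathcal C$, and every embedding $\mathbb A\to\mathbb B$ between members of $\mathcal C$ is also an embedding $F(\mathbb A)\to F(\mathbb B)$. Algorithms are programs for a word RAM: unit-cost arithmetic operations and comparisons on words of $O(\log n)$ bits, a random access memory, a random access input, and an output to which words are appended. A structure with $n$ vertices is encoded, with respect to an enumeration of its vertices, by the number $n$ followed by the $0/1$ tables, with $n^k$ entries for a symbol of arity $k$, of its relations. An algorithm computes $F$ in time $T(n)$ if, for every $\mathbb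 A\in\mathcal C$ with $n$ vertices and every enumeration of its vertices, it turns the encoding of $\mathbb A$ into the encoding of $F(\mathbb A)$ in at most $T(n)$ steps. \textbf{Theorem.} Let $\sigma$ and $\tau$ be finite relational signatures. (1) If $\mathcal C$ and $\mathcal D$ are hereditary classes of $\sigma$-structures and of $\tau$-structures, respectively, then every concrete functor $F\colon\mathcal C\to\mathcal D$ is computable in time polynomial in the number $n$ of vertices. (2) Every concrete functor $F\colon\mathrm{Mod}_\sigma\to\mathrm{Mod}_\tau$ is computable in time $O(n^r)$, where $n$ is the number of vertices of the input and $r$ is the largest arity of a relation symbol in $\tau$. -/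

import Mathlib

universe u v u' v' w

/-! ## Hereditary classes of finite relational structures and concrete functors

Relational signatures, structures and embeddings are those of Mathlib's model theory
(`FirstOrder.Language`, `FirstOrder.Language.Structure`, `FirstOrder.Language.Embedding`). -/

/-- The function `f` is an embedding of the `L`-structure `A` on the vertex set `V` into
the `L`-structure `B` on the vertex set `W`. -/
def IsEmbeddingOf (L : FirstOrder.Language.{u, v}) {V W : Type w}
    (A : L.Structure V) (B : L.Structure W) (f : V → W) : Prop :=
  ∃ φ : @FirstOrder.Language.Embedding L V W A B, @DFunLike.coe _ V (fun _ => W)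
    (@FirstOrder.Language.Embedding.funLike L V W A B) φ = f

/-- A hereditary class: a class of finite `L`-structures that is closed under embeddings (hence
also under isomorphisms). -/
structure HereditaryClass (L : FirstOrder.Language.{u, v}) where
  /-- the members of the class -/
  carrier : Set (CategoryTheory.Bundled.{w} L.Structure)
  finite : ∀ A ∈ carrier, Finite A
  closed : ∀ A ∈ carrier, ∀ B : CategoryTheory.Bundled.{w} L.Structure,
    Nonempty (L.Embedding B A) → B ∈ carrier

/-- `Mod_L`, the class of all finite `L`-structures. -/
def HereditaryClass.all (L : FirstOrder.Language.{u, v}) : HereditaryClass.{u, v, w} L where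
  carrier := {A | Finite A}
  finite := fun _ hA => hA
  closed := fun A hA _ ⟨f⟩ =>
    have : Finite A := hA
    Finite.of_injective f f.injective

/-- A concrete functor `F : C → D` between hereditary classes, seen as categories whose morphisms
are the embeddings: a functor with `F f = f` for every embedding `f`. Since `F` fixes identity
maps, `F A` has the same vertex set as `A`, so that `F` is given on objects by a `τ`-structure on
the vertex set of `A`; and since `F` is the identity on morphisms, it only has to be required that
every embedding `A → B` is also an embedding `F A → F B`. -/
structure ConcreteFunctor {σ : FirstOrder.Language.{u, v}} {τ : FirstOrder.Language.{u', v'}}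
    (C : HereditaryClass.{u, v, w} σ) (D : HereditaryClass.{u', v', w} τ) where
  /-- the structure `F A` on the vertex set of `A` -/
  obj : ∀ A : CategoryTheory.Bundled.{w} σ.Structure, A ∈ C.carrier → τ.Structure A
  obj_mem : ∀ (A : CategoryTheory.Bundled.{w} σ.Structure) (hA : A ∈ C.carrier),
    (⟨A, obj A hA⟩ : CategoryTheory.Bundled.{w} τ.Structure) ∈ D.carrier
  map_embedding : ∀ (A : CategoryTheory.Bundled.{w} σ.Structure) (hA : A ∈ C.carrier)
    (B : CategoryTheory.Bundled.{w} σ.Structure) (hB : B ∈ C.carrier) (f : σ.Embedding A B),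
    IsEmbeddingOf τ (obj A hA) (obj B hB) f

/-! ## A word RAM

Programs of a random access machine in structured form. The machine has a read-only random access
input, a random access memory, and a write-only output to which words are appended. A word is a
natural number below the modulus `W`, and every operation has unit cost. -/

namespace WordRAM

/-- The binary operations on words. -/
inductive BinOp where
  | add | sub | mul | div | mod | eq | lt

/-- The value of a binary operation, before reduction modulo the word modulus. Subtraction is
truncated at `0`, division rounds down, and a test has the value `1` or `0`. -/
def BinOp.apply : BinOp → ℕ → ℕ → ℕ
  | .add, a, b => a + b
  | .sub, a, b => a - b
  | .mul, a, b => a * b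
  | .div, a, b => a / b
  | .mod, a, b => a % b
  | .eq, a, b => if a = b then 1 else 0
  | .lt, a, b => if a < b then 1 else 0

/-- Expressions: constants, the content of the memory cell with address `a`, the input word with
index `a`, and binary operations. -/
inductive Expr where
  | const (k : ℕ)
  | cell (a : Expr)
  | input (a : Expr)
  | op (o : BinOp) (a b : Expr)

/-- The value of an expression, for the word modulus `W`, the input `x` and the memory `m`.
Input words are numbered from `0`; beyond the end of the input `0` is read. -/
def Expr.eval (W : ℕ) (x : List ℕ) (m : ℕ → ℕ) : Expr → ℕ
  | .const k => k % W
  | .cell a => m (a.eval W x m) % W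
  | .input a => x.getD (a.eval W x m) 0 % W
  | .op o a b => o.apply (a.eval W x m) (b.eval W x m) % W

/-- The number of steps for the evaluation of an expression: one for each constant, each memory or
input access, and each operation. -/
def Expr.cost : Expr → ℕ
  | .const _ => 1
  | .cell a => a.cost + 1
  | .input a => a.cost + 1
  | .op _ a b => a.cost + b.cost + 1

/-- Programs. `store a e` writes the value of `e` to the memory cell with address `a`, and
`write e` appends the value of `e` to the output. A test succeeds if its value is not `0`. -/
inductive Prog where
  | skip
  | store (a e : Expr)
  | write (e : Expr)
  | seq (P Q : Prog)
  | ite (e : Expr) (P Q : Prog)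
  | while (e : Expr) (P : Prog)

/-- The state of the machine: the memory, and the output written so far. -/
structure State where
  mem : ℕ → ℕ
  out : List ℕ

/-- In the initial state all memory cells hold `0` and the output is empty. -/
def State.init : State := ⟨fun _ => 0, []⟩

/-- `Exec W x P s t s'`: with word modulus `W` and input `x`, the program `P`, started in the
state `s`, halts after exactly `t` steps in the state `s'`. -/
inductive Exec (W : ℕ) (x : List ℕ) : Prog → State → ℕ → State → Prop where
  | skip (s : State) : Exec W x .skip s 1 s
  | store (a e : Expr) (s : State) :
      Exec W x (.store a e) s (a.cost + e.cost + 1)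
        ⟨Function.update s.mem (a.eval W x s.mem) (e.eval W x s.mem), s.out⟩
  | write (e : Expr) (s : State) :
      Exec W x (.write e) s (e.cost + 1) ⟨s.mem, s.out ++ [e.eval W x s.mem]⟩
  | seq {P Q : Prog} {s s₁ s₂ : State} {t₁ t₂ : ℕ} :
      Exec W x P s t₁ s₁ → Exec W x Q s₁ t₂ s₂ → Exec W x (.seq P Q) s (t₁ + t₂) s₂
  | ite_true {e : Expr} {P Q : Prog} {s s₁ : State} {t : ℕ} : e.eval W x s.mem ≠ 0 →
      Exec W x P s t s₁ → Exec W x (.ite e P Q) s (e.cost + 1 + t) s₁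
  | ite_false {e : Expr} {P Q : Prog} {s s₁ : State} {t : ℕ} : e.eval W x s.mem = 0 →
      Exec W x Q s t s₁ → Exec W x (.ite e P Q) s (e.cost + 1 + t) s₁
  | while_true {e : Expr} {P : Prog} {s s₁ s₂ : State} {t₁ t₂ : ℕ} : e.eval W x s.mem ≠ 0 →
      Exec W x P s t₁ s₁ → Exec W x (.while e P) s₁ t₂ s₂ →
      Exec W x (.while e P) s (e.cost + 1 + t₁ + t₂) s₂
  | while_false {e : Expr} {P : Prog} {s : State} : e.eval W x s.mem = 0 →
      Exec W x (.while e P) s (e.cost + 1) s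

/-- The word modulus for words of `c * (⌊log₂ n⌋ + 1)` bits. -/
def modulus (c n : ℕ) : ℕ := 2 ^ (c * (Nat.log 2 n + 1))

end WordRAM

/-! ## Computing a concrete functor -/

open Classical in
/-- The standard encoding of an `L`-structure on a vertex set `V` that is enumerated by `e`, for
the listing `S` of the relation symbols: the number `n` of vertices, followed, for each symbol in
turn, by the table with `n ^ k` entries of its interpretation, where `k` is the arity. The entry
with number `a₀ + a₁ n + ⋯ + aₖ₋₁ n ^ (k - 1)` is `1` if the tuple with the numbers
`(a₀, …, aₖ₋₁)` is in the relation, and `0` otherwise. -/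
noncomputable def encodeStructure {L : FirstOrder.Language.{u, v}} {p : ℕ}
    (S : Fin p ≃ Σ k, L.Relations k) {V : Type w} (A : L.Structure V) {n : ℕ}
    (e : Fin n ≃ V) : List ℕ :=
  n :: (List.ofFn S).flatMap fun R =>
    List.ofFn fun i : Fin (n ^ R.1) =>
      if A.RelMap R.2 (fun j => e (finFunctionFinEquiv.symm i j)) then 1 else 0

/-- The largest arity of a relation symbol (`0` if there is no symbol). -/
def maxArity {L : FirstOrder.Language.{u, v}} {p : ℕ} (S : Fin p ≃ Σ k, L.Relations k) : ℕ :=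
  Finset.univ.sup fun i => (S i).1

namespace ConcreteFunctor

variable {σ : FirstOrder.Language.{u, v}} {τ : FirstOrder.Language.{u', v'}} {p q : ℕ}
  {C : HereditaryClass.{u, v, w} σ} {D : HereditaryClass.{u', v', w} τ}

/-- The functor `F` is computed in time `T`: there is a program that, with words of `O(log n)`
bits, for every structure `A` in `C` with `n` vertices and every enumeration of its vertices,
outputs the encoding of `F A` on input of the encoding of `A`, after at most `T n` steps. -/
def ComputableInTime (F : ConcreteFunctor C D) (Sσ : Fin p ≃ Σ k, σ.Relations k)
    (Sτ : Fin q ≃ Σ k, τ.Relations k) (T : ℕ → ℕ) : Prop :=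
  ∃ (P : WordRAM.Prog) (c : ℕ),
    ∀ (A : CategoryTheory.Bundled.{w} σ.Structure) (hA : A ∈ C.carrier) (n : ℕ) (e : Fin n ≃ A),
      ∃ (t : ℕ) (m : ℕ → ℕ), t ≤ T n ∧
        WordRAM.Exec (WordRAM.modulus c n) (encodeStructure Sσ A.str e) P WordRAM.State.init t
          ⟨m, encodeStructure Sτ (F.obj A hA) e⟩

/-- The functor `F` is computable in time polynomial in the number of vertices. -/
def ComputableInPolyTime (F : ConcreteFunctor C D) (Sσ : Fin p ≃ Σ k, σ.Relations k)
    (Sτ : Fin q ≃ Σ k, τ.Relations k) : Prop :=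
  ∃ f : Polynomial ℕ, F.ComputableInTime Sσ Sτ fun n => f.eval n

end ConcreteFunctor

/-! A concrete functor is a quantifier-free interpretation. The vertices of a `k`-tuple `a` in `A`
span an induced substructure, which lies in the class by heredity. If `b` in `B` has the same
quantifier-free type, then `a i ↦ b i` is well defined and embeds this substructure in `B`.
Embeddings survive `F`, so `F A` and `F B` agree on `a` and `b` (`relMap_iff_of_holds_eq`).

There are finitely many atomic formulas in `k` variables, so each relation of `F A` is a fixed
Boolean function of them. Each atom costs a bounded number of input accesses and operations
(`Atom.eval_expr`), so one fixed expression yields any table entry in constant time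
(`ConcreteFunctor.exists_expr`). Writing all tables takes `O(n ^ r)` steps (`exec_tables`). The
arities of `σ` affect only the constant and the word length, since the input is never read in full.
The bound holds for all hereditary classes and gives both claims. -/

namespace WordRAM

/-! ### Expressions -/

/-- The input word with index `0`: the number of vertices. -/
def Expr.size : Expr := .input (.const 0)

/-- The `k`-th power of the number of vertices. -/
def Expr.sizePow : ℕ → Expr
  | 0 => .const 1
  | k + 1 => .op .mul (Expr.sizePow k) .size

/-- The sum of a list of expressions. -/
def Expr.sum : List Expr → Expr
  | [] => .const 0
  | a :: l => .op .add a (Expr.sum l)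

/-- The digit with number `j` of the content of cell `0`, in base the number of vertices. -/
def Expr.digit (j : ℕ) : Expr :=
  .op .mod (.op .div (.cell (.const 0)) (.sizePow j)) .size

section Eval

variable {W : ℕ} {x : List ℕ} {m : ℕ → ℕ}

theorem Expr.eval_size {n : ℕ} (hx : x.getD 0 0 = n) : Expr.size.eval W x m = n % W := by
  simp only [Expr.size, Expr.eval, Nat.zero_mod, hx]

theorem Expr.eval_sizePow {n : ℕ} (hx : x.getD 0 0 = n) (k : ℕ) :
    (Expr.sizePow k).eval W x m = n ^ k % W := by
  induction k with
  | zero => simp [Expr.sizePow, Expr.eval]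
  | succ k ih =>
    simp only [Expr.sizePow, Expr.eval, ih, Expr.eval_size hx, BinOp.apply, pow_succ]
    exact (Nat.mul_mod _ _ _).symm

theorem Expr.eval_sum {ι : Type*} (l : List ι) (E : ι → Expr) (a : ι → ℕ)
    (h : ∀ i ∈ l, (E i).eval W x m = a i % W) :
    (Expr.sum (l.map E)).eval W x m = (l.map a).sum % W := by
  induction l with
  | nil => simp [Expr.sum, Expr.eval]
  | cons i l ih =>
    simp only [List.map_cons, Expr.sum, Expr.eval, BinOp.apply, List.sum_cons]
    rw [ih fun j hj => h j (List.mem_cons_of_mem _ hj), h i List.mem_cons_self]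
    exact (Nat.add_mod _ _ _).symm

theorem Expr.eval_digit {n i j : ℕ} (hx : x.getD 0 0 = n) (hn : n < W) (hi : m 0 = i)
    (hiW : i < W) (hj : n ^ j < W) :
    (Expr.digit j).eval W x m = i / n ^ j % n := by
  simp only [Expr.digit, Expr.eval, BinOp.apply, Nat.zero_mod, hi, Expr.eval_sizePow hx,
    Expr.eval_size hx, Nat.mod_eq_of_lt hn, Nat.mod_eq_of_lt hiW, Nat.mod_eq_of_lt hj,
    Nat.mod_eq_of_lt ((Nat.div_le_self _ _).trans_lt hiW)]
  exact Nat.mod_eq_of_lt (((Nat.mod_le _ _).trans (Nat.div_le_self _ _)).trans_lt hiW)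

end Eval

open Classical in
/-- Every Boolean function of finitely many tests is the value of an expression. -/
theorem exists_expr_of_list {α : Type*} (ex : α → Expr) (l : List α) :
    ∀ f : (α → Prop) → Prop, (∀ v v', (∀ a ∈ l, v a ↔ v' a) → (f v ↔ f v')) →
    ∃ E : Expr, ∀ (W : ℕ) (x : List ℕ) (m : ℕ → ℕ) (v : α → Prop), 1 < W →
      (∀ a, (ex a).eval W x m = if v a then 1 else 0) →
      E.eval W x m = if f v then 1 else 0 := by
  induction l with
  | nil =>
    intro f hf
    refine ⟨.const (if f fun _ => True then 1 else 0), fun W x m v hW _ => ?_⟩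
    rw [Expr.eval, if_congr (hf v (fun _ => True) (by simp)) rfl rfl]
    split_ifs
    · exact Nat.mod_eq_of_lt hW
    · exact Nat.zero_mod _
  | cons a l ih =>
    intro f hf
    -- Shannon expansion: once the truth value of `a` is fixed, `f` depends only on the tests in
    -- `l`.
    have key : ∀ b : Prop, ∃ E : Expr, ∀ (W : ℕ) (x : List ℕ) (m : ℕ → ℕ) (v : α → Prop), 1 < W →
        (∀ a, (ex a).eval W x m = if v a then 1 else 0) →
        E.eval W x m = if f (Function.update v a b) then 1 else 0 := by
      intro b
      refine ih (fun v => f (Function.update v a b)) fun v v' h => hf _ _ fun c hc => ?_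
      by_cases hca : c = a
      · subst hca; simp
      · rw [Function.update_of_ne hca, Function.update_of_ne hca]
        exact h c ((List.mem_cons.1 hc).resolve_left hca)
    obtain ⟨E₁, h₁⟩ := key True
    obtain ⟨E₀, h₀⟩ := key False
    refine ⟨.op .add (.op .mul (ex a) E₁) (.op .mul (.op .sub (.const 1) (ex a)) E₀),
      fun W x m v hW hv => ?_⟩
    have h1 : 1 % W = 1 := Nat.mod_eq_of_lt hW
    simp only [Expr.eval, BinOp.apply, h₁ W x m v hW hv, h₀ W x m v hW hv, hv a]
    by_cases hva : v a
    · have : Function.update v a True = v := by simp [hva]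
      rw [this]
      by_cases hfv : f v <;> simp [hva, hfv, h1]
    · have : Function.update v a False = v := by simp [hva]
      rw [this]
      by_cases hfv : f v <;> simp [hva, hfv, h1]

open Classical in
theorem exists_expr {α : Type*} [Finite α] (ex : α → Expr) (f : (α → Prop) → Prop) :
    ∃ E : Expr, ∀ (W : ℕ) (x : List ℕ) (m : ℕ → ℕ) (v : α → Prop), 1 < W →
      (∀ a, (ex a).eval W x m = if v a then 1 else 0) →
      E.eval W x m = if f v then 1 else 0 := by
  have := Fintype.ofFinite α
  refine exists_expr_of_list ex Finset.univ.toList f fun v v' h => ?_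
  rw [show v = v' from funext fun a => propext (h a (by simp))]

/-! ### Loops -/

/-- The program that writes the values of `E` while cell `0` counts up to `n ^ k`. -/
def Prog.countLoop (k : ℕ) (E : Expr) : Prog :=
  .while (.op .lt (.cell (.const 0)) (.sizePow k))
    (.seq (.write E) (.store (.const 0) (.op .add (.cell (.const 0)) (.const 1))))

/-- The program that writes the table with `n ^ k` entries that are the values of `E`. -/
def Prog.table (k : ℕ) (E : Expr) : Prog :=
  .seq (.store (.const 0) (.const 0)) (.countLoop k E)

/-- The program that writes the tables for a list of expressions, one after the other. -/
def Prog.tables : List (ℕ × Expr) → Prog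
  | [] => .skip
  | a :: l => .seq (.table a.1 a.2) (Prog.tables l)

/-- Induction on the number `d` of entries still to be written. `K` is the cost of one full round;
the additive `K` pays for the final failing test. As `n ^ k < W`, the counter never wraps around. -/
theorem exec_countLoop (k : ℕ) (E : Expr) : ∃ K : ℕ, ∀ (W : ℕ) (x : List ℕ) (n : ℕ) (b : ℕ → ℕ),
    1 < W → x.getD 0 0 = n → n ^ k < W →
    (∀ (m : ℕ → ℕ) (i : ℕ), m 0 = i → i < n ^ k → E.eval W x m = b i) →
    ∀ (d i : ℕ) (s : State), i + d = n ^ k → s.mem 0 = i →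
    ∃ (t : ℕ) (m : ℕ → ℕ), t ≤ K * d + K ∧ Exec W x (.countLoop k E) s t
      ⟨m, s.out ++ List.ofFn fun j : Fin d => b (i + j)⟩ := by
  refine ⟨(Expr.op .lt (.cell (.const 0)) (.sizePow k)).cost + 1 +
    ((E.cost + 1) + ((Expr.const 0).cost + (Expr.op .add (.cell (.const 0)) (.const 1)).cost + 1)),
    fun W x n b hW hx hn hE d => ?_⟩
  have cond : ∀ s : State, s.mem 0 ≤ n ^ k →
      (Expr.op .lt (.cell (.const 0)) (.sizePow k)).eval W x s.mem =
        if s.mem 0 < n ^ k then 1 else 0 := by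
    intro s hs
    simp only [Expr.eval, BinOp.apply, Nat.zero_mod, Expr.eval_sizePow hx, Nat.mod_eq_of_lt hn,
      Nat.mod_eq_of_lt (hs.trans_lt hn)]
    split_ifs
    · exact Nat.mod_eq_of_lt hW
    · exact Nat.zero_mod _
  induction d with
  | zero =>
    intro i s hi hs
    refine ⟨(Expr.op .lt (.cell (.const 0)) (.sizePow k)).cost + 1, s.mem, by omega, ?_⟩
    · rw [List.ofFn_zero, List.append_nil]
      refine Exec.while_false ?_
      rw [cond s (by omega), if_neg (by omega)]
  | succ d ih =>
    intro i s hi hs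
    obtain ⟨t, m, ht, hex⟩ := ih (i + 1)
      ⟨Function.update s.mem 0 (i + 1), s.out ++ [b i]⟩ (by omega) (by simp)
    have hst : Exec W x
        (.seq (.write E) (.store (.const 0) (.op .add (.cell (.const 0)) (.const 1)))) s
        ((E.cost + 1) +
          ((Expr.const 0).cost + (Expr.op .add (.cell (.const 0)) (.const 1)).cost + 1))
        ⟨Function.update s.mem 0 (i + 1), s.out ++ [b i]⟩ := by
      have h1 := Exec.write (W := W) (x := x) E s
      rw [hE s.mem i hs (by omega)] at h1
      have h2 := Exec.store (W := W) (x := x) (.const 0)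
        (.op .add (.cell (.const 0)) (.const 1)) ⟨s.mem, s.out ++ [b i]⟩
      simp only [Expr.eval, BinOp.apply, Nat.zero_mod, hs, Nat.mod_eq_of_lt hW,
        Nat.mod_eq_of_lt (show i < W by omega), Nat.mod_eq_of_lt (show i + 1 < W by omega)] at h2
      exact h1.seq h2
    have hcond : (Expr.op .lt (.cell (.const 0)) (.sizePow k)).eval W x s.mem ≠ 0 := by
      rw [cond s (by omega), if_pos (by omega)]
      exact one_ne_zero
    refine ⟨(Expr.op .lt (.cell (.const 0)) (.sizePow k)).cost + 1 + ((E.cost + 1) +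
      ((Expr.const 0).cost + (Expr.op .add (.cell (.const 0)) (.const 1)).cost + 1)) + t, m, ?_, ?_⟩
    rotate_left
    · have := Exec.while_true hcond hst hex
      rw [List.ofFn_succ, List.append_cons]
      simpa [Prog.countLoop, add_assoc, add_comm, add_left_comm] using this
    · rw [Nat.mul_succ]
      omega

theorem exec_table (k : ℕ) (E : Expr) : ∃ K : ℕ, ∀ (W : ℕ) (x : List ℕ) (n : ℕ) (b : ℕ → ℕ),
    1 < W → x.getD 0 0 = n → n ^ k < W →
    (∀ (m : ℕ → ℕ) (i : ℕ), m 0 = i → i < n ^ k → E.eval W x m = b i) →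
    ∀ s : State, ∃ (t : ℕ) (m : ℕ → ℕ), t ≤ K * n ^ k + K ∧ Exec W x (.table k E) s t
      ⟨m, s.out ++ List.ofFn fun j : Fin (n ^ k) => b j⟩ := by
  obtain ⟨K, hK⟩ := exec_countLoop k E
  -- Resetting the counter costs 3 steps.
  refine ⟨K + 3, fun W x n b hW hx hn hE s => ?_⟩
  obtain ⟨t, m, ht, hex⟩ := hK W x n b hW hx hn hE (n ^ k) 0
    ⟨Function.update s.mem 0 0, s.out⟩ (by omega) (by simp)
  have h2 := Exec.store (W := W) (x := x) (.const 0) (.const 0) s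
  simp only [Expr.eval, Nat.zero_mod] at h2
  simp only [Nat.zero_add] at hex
  refine ⟨_, m, ?_, h2.seq hex⟩
  simp only [Expr.cost]
  rw [add_mul]
  omega

theorem exec_tables {ι : Type*} (k : ι → ℕ) (E : ι → Expr) (r : ℕ) (l : List ι)
    (hr : ∀ i ∈ l, k i ≤ r) :
    ∃ K : ℕ, ∀ (W : ℕ) (x : List ℕ) (n : ℕ) (b : ι → ℕ → ℕ),
    1 < W → x.getD 0 0 = n → (∀ i ∈ l, n ^ k i < W) →
    (∀ j ∈ l, ∀ (m : ℕ → ℕ) (i : ℕ), m 0 = i → i < n ^ k j → (E j).eval W x m = b j i) →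
    ∀ s : State, ∃ (t : ℕ) (m : ℕ → ℕ), t ≤ K * n ^ r + K ∧
      Exec W x (.tables (l.map fun i => (k i, E i))) s t
      ⟨m, s.out ++ l.flatMap fun i => List.ofFn fun j : Fin (n ^ k i) => b i j⟩ := by
  induction l with
  | nil =>
    refine ⟨1, fun W x n b hW hx hn hE s => ⟨1, s.mem, by omega, ?_⟩⟩
    simpa [Prog.tables] using Exec.skip s
  | cons i l ih =>
    obtain ⟨K₁, h₁⟩ := exec_table (k i) (E i)
    obtain ⟨K₂, h₂⟩ := ih fun j hj => hr j (List.mem_cons_of_mem _ hj)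
    refine ⟨K₁ + K₁ + K₂, fun W x n b hW hx hn hE s => ?_⟩
    obtain ⟨t₁, m₁, ht₁, he₁⟩ := h₁ W x n (b i) hW hx (hn i List.mem_cons_self)
      (hE i List.mem_cons_self) s
    obtain ⟨t₂, m₂, ht₂, he₂⟩ := h₂ W x n b hW hx (fun j hj => hn j (List.mem_cons_of_mem _ hj))
      (fun j hj => hE j (List.mem_cons_of_mem _ hj)) ⟨m₁, _⟩
    refine ⟨t₁ + t₂, m₂, ?_, ?_⟩
    -- The summand 1 is needed for `n = 0`, where `0 ^ 0 = 1` may exceed `0 ^ r`; it accounts for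
    -- the second `K₁`.
    · have : n ^ k i ≤ n ^ r + 1 := by
        rcases Nat.eq_zero_or_pos n with rfl | h0
        · exact (pow_le_one₀ le_rfl zero_le_one).trans (Nat.le_add_left _ _)
        · exact (Nat.pow_le_pow_right h0 (hr i List.mem_cons_self)).trans (Nat.le_succ _)
      nlinarith [Nat.mul_le_mul_left K₁ this, Nat.zero_le (K₁ * n ^ r)]
    · have := he₁.seq he₂
      rw [List.append_assoc] at this
      exact this

/-! ### Word size -/

theorem modulus_eq_pow (c n : ℕ) : modulus c n = (2 ^ (Nat.log 2 n + 1)) ^ c := by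
  rw [modulus, mul_comm, pow_mul]

theorem pow_lt_modulus {k c : ℕ} (n : ℕ) (h : k < c) : n ^ k < modulus c n := by
  have hb : n < 2 ^ (Nat.log 2 n + 1) := Nat.lt_pow_succ_log_self one_lt_two n
  rw [modulus_eq_pow]
  exact (Nat.pow_le_pow_left hb.le k).trans_lt
    (Nat.pow_lt_pow_right (Nat.one_lt_two_pow (Nat.succ_ne_zero _)) h)

/-- With `b = 2 ^ (Nat.log 2 n + 1)`, both `p + 1 ≤ b ^ p` and `n + 1 ≤ b`. The left side bounds the
length of an encoding, so input addresses fit in a word. -/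
theorem succ_mul_pow_le_modulus {p s c : ℕ} (n : ℕ) (h : p + s ≤ c) :
    (p + 1) * (n + 1) ^ s ≤ modulus c n := by
  have hb : n < 2 ^ (Nat.log 2 n + 1) := Nat.lt_pow_succ_log_self one_lt_two n
  have h2 : 2 ≤ 2 ^ (Nat.log 2 n + 1) := Nat.le_self_pow (Nat.succ_ne_zero _) 2
  rw [modulus_eq_pow]
  calc (p + 1) * (n + 1) ^ s
      ≤ (2 ^ (Nat.log 2 n + 1)) ^ p * (2 ^ (Nat.log 2 n + 1)) ^ s :=
        Nat.mul_le_mul (Nat.lt_two_pow_self.trans_le (Nat.pow_le_pow_left h2 p))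
          (Nat.pow_le_pow_left hb s)
    _ = (2 ^ (Nat.log 2 n + 1)) ^ (p + s) := (pow_add _ _ _).symm
    _ ≤ _ := Nat.pow_le_pow_right (by omega) h

end WordRAM

/-! ### Reading the encoding of a structure -/

theorem List.getD_flatMap_take {ι : Type*} (g : ι → List ℕ) (l : List ι) (i : ℕ) {r : ι}
    (hr : l[i]? = some r) (j : ℕ) (hj : j < (g r).length) :
    (l.flatMap g).getD (((l.take i).map fun a => (g a).length).sum + j) 0 = (g r)[j] := by
  induction l generalizing i with
  | nil => simp at hr
  | cons a l ih =>
    cases i with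
    | zero =>
      obtain rfl : a = r := by simpa using hr
      rw [List.take_zero, List.map_nil, List.sum_nil, zero_add, List.flatMap_cons,
        List.getD_append _ _ _ _ hj, List.getD_eq_getElem _ _ hj]
    | succ i =>
      rw [← ih i (by simpa using hr), List.flatMap_cons, List.take_succ_cons, List.map_cons,
        List.sum_cons, List.getD_append_right _ _ _ _ (by omega)]
      congr 1
      omega

theorem List.sum_take_add_lt_length_flatMap {ι : Type*} (g : ι → List ℕ) (l : List ι) (i : ℕ)
    {r : ι} (hr : l[i]? = some r) (j : ℕ) (hj : j < (g r).length) :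
    ((l.take i).map fun a => (g a).length).sum + j < (l.flatMap g).length := by
  induction l generalizing i with
  | nil => simp at hr
  | cons a l ih =>
    cases i with
    | zero =>
      obtain rfl : a = r := by simpa using hr
      simp only [List.take_zero, List.map_nil, List.sum_nil, List.flatMap_cons,
        List.length_append]
      omega
    | succ i =>
      have := ih i (by simpa using hr)
      simp only [List.take_succ_cons, List.map_cons, List.sum_cons, List.flatMap_cons,
        List.length_append]
      omega

section Encoding

variable {L : FirstOrder.Language.{u, v}} {p : ℕ} (S : Fin p ≃ Σ k, L.Relations k)

theorem le_maxArity {R : Σ k, L.Relations k} (hR : R ∈ List.ofFn S) : R.1 ≤ maxArity S := by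
  obtain ⟨i, rfl⟩ := (List.mem_ofFn' _ _).1 hR
  exact Finset.le_sup (f := fun i => (S i).1) (Finset.mem_univ i)

theorem pow_le_succ_pow_maxArity {R : Σ k, L.Relations k} (hR : R ∈ List.ofFn S) (n : ℕ) :
    n ^ R.1 ≤ (n + 1) ^ maxArity S :=
  (Nat.pow_le_pow_left (Nat.le_succ n) _).trans
    (Nat.pow_le_pow_right (Nat.succ_pos n) (le_maxArity S hR))

variable {V : Type w} (A : L.Structure V) {n : ℕ} (e : Fin n ≃ V)

theorem length_encodeStructure_le :
    (encodeStructure S A e).length ≤ (p + 1) * (n + 1) ^ maxArity S := by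
  have h := List.sum_le_card_nsmul ((List.ofFn S).map fun R => n ^ R.1) ((n + 1) ^ maxArity S)
    (by
      intro y hy
      obtain ⟨R, hR, rfl⟩ := List.mem_map.1 hy
      exact pow_le_succ_pow_maxArity S hR n)
  have h1 := Nat.one_le_pow (maxArity S) (n + 1) (Nat.succ_pos n)
  simp only [List.length_map, List.length_ofFn, smul_eq_mul] at h
  simp only [encodeStructure, List.length_cons, List.length_flatMap, List.length_ofFn]
  rw [add_mul]
  omega

open Classical in
/-- The position of an entry of a table in the encoding of a structure. -/
theorem getD_encodeStructure (i : Fin p) (j : Fin (n ^ (S i).1)) :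
    ((((List.ofFn S).take i).map fun R => n ^ R.1).sum + j) + 1 < (encodeStructure S A e).length ∧
    (encodeStructure S A e).getD
      (((((List.ofFn S).take i).map fun R => n ^ R.1).sum + j) + 1) 0 =
      if A.RelMap (S i).2 (fun k => e (finFunctionFinEquiv.symm j k)) then 1 else 0 := by
  have hr : (List.ofFn S)[(i : ℕ)]? = some (S i) := by simp
  let g : (Σ k, L.Relations k) → List ℕ := fun R => List.ofFn fun i : Fin (n ^ R.1) =>
    if A.RelMap R.2 (fun j => e (finFunctionFinEquiv.symm i j)) then 1 else 0
  have hlen : ∀ R, (g R).length = n ^ R.1 := fun R => List.length_ofFn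
  have hj : (j : ℕ) < (g (S i)).length := by rw [hlen]; exact j.2
  have h1 := List.sum_take_add_lt_length_flatMap g _ i hr j hj
  have h2 := List.getD_flatMap_take g _ i hr j hj
  simp only [hlen] at h1 h2
  refine ⟨Nat.succ_lt_succ h1, ?_⟩
  rw [encodeStructure, List.getD_cons_succ]
  refine h2.trans ?_
  simp [g]

end Encoding

/-! ### Quantifier-free types -/

section Atoms

variable {L : FirstOrder.Language.{u, v}} {p : ℕ} (S : Fin p ≃ Σ k, L.Relations k) (k : ℕ)

/-- The atomic formulas in `k` variables. -/
abbrev Atom : Type := (Fin k × Fin k) ⊕ (Σ i : Fin p, Fin (S i).1 → Fin k)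

variable {k}

/-- The tuple `a` satisfies an atomic formula. -/
def Atom.Holds {V : Type w} (A : L.Structure V) (a : Fin k → V) : Atom S k → Prop
  | .inl ij => a ij.1 = a ij.2
  | .inr ig => A.RelMap (S ig.1).2 fun j => a (ig.2 j)

open WordRAM in
/-- The expression for the value of an atomic formula at the tuple with the number in cell `0`. -/
def Atom.expr : Atom S k → Expr
  | .inl ij => .op .eq (.digit ij.1) (.digit ij.2)
  | .inr ig => .input (.op .add
      (.op .add (.sum (((List.ofFn S).take ig.1).map fun R => .sizePow R.1))
        (.sum ((List.finRange (S ig.1).1).map fun j => .op .mul (.digit (ig.2 j)) (.sizePow j))))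
      (.const 1))

-- Since `e` is injective, equality of vertices is equality of digits. For a relational atom, the
-- digits selected by `g` are reassembled into the number of the subtuple; adding the lengths of the
-- preceding tables, and 1 for the leading word `n`, gives its address.
open WordRAM Classical in
theorem Atom.eval_expr {V : Type w} (A : L.Structure V) {n : ℕ} (e : Fin n ≃ V) {W : ℕ}
    (hW : 1 < W) (hn : n < W) (hk : ∀ j ≤ k, n ^ j < W)
    (hlen : (encodeStructure S A e).length ≤ W) {m : ℕ → ℕ} (i : Fin (n ^ k)) (hm : m 0 = i)
    (a : Atom S k) :
    (Atom.expr S a).eval W (encodeStructure S A e) m =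
      if Atom.Holds S A (fun j => e (finFunctionFinEquiv.symm i j)) a then 1 else 0 := by
  have hx : (encodeStructure S A e).getD 0 0 = n := rfl
  have hd : ∀ j : Fin k, (Expr.digit j).eval W (encodeStructure S A e) m =
      (finFunctionFinEquiv.symm i j : ℕ) := fun j =>
    Expr.eval_digit hx hn hm (i.2.trans (hk k le_rfl)) (hk j j.2.le)
  rcases a with ⟨j₁, j₂⟩ | ⟨s, g⟩
  · simp only [Atom.expr, Atom.Holds, Expr.eval, BinOp.apply, hd, Fin.val_inj,
      EmbeddingLike.apply_eq_iff_eq]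
    split_ifs
    · exact Nat.mod_eq_of_lt hW
    · exact Nat.zero_mod _
  · obtain ⟨h1, h2⟩ := getD_encodeStructure S A e s
      (finFunctionFinEquiv fun j => finFunctionFinEquiv.symm i (g j))
    have hoff := Expr.eval_sum (W := W) (x := encodeStructure S A e) (m := m)
      ((List.ofFn S).take s) (fun R => .sizePow R.1) (fun R => n ^ R.1)
      fun R _ => Expr.eval_sizePow hx _
    have hidx := Expr.eval_sum (W := W) (x := encodeStructure S A e) (m := m)
      (List.finRange (S s).1) (fun j => .op .mul (.digit (g j)) (.sizePow j))
      (fun j => (finFunctionFinEquiv.symm i (g j) : ℕ) * n ^ (j : ℕ))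
      fun j _ => by
        simp only [Expr.eval, BinOp.apply, hd, Expr.eval_sizePow hx]
        exact Nat.mul_mod_mod _ _ _
    rw [← Fin.sum_univ_def, ← finFunctionFinEquiv_apply
      (fun j => finFunctionFinEquiv.symm i (g j))] at hidx
    simp only [Equiv.symm_apply_apply] at h2
    simp only [Atom.expr, Expr.eval, BinOp.apply, hoff, hidx]
    -- Intermediate reductions are harmless: the final address is below the input length, hence
    -- below `W`.
    have hmod : ∀ a b, (a % W + b % W + 1) % W = (a + b + 1) % W := fun a b =>
      ((Nat.mod_modEq a W).add (Nat.mod_modEq b W)).add_right 1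
    rw [← Nat.add_mod, hmod, Nat.mod_eq_of_lt (h1.trans_le hlen), h2]
    refine Eq.trans ?_ (if_congr (P := A.RelMap (S s).2 fun j =>
      e (finFunctionFinEquiv.symm i (g j))) Iff.rfl rfl rfl)
    split_ifs
    · exact Nat.mod_eq_of_lt hW
    · exact Nat.zero_mod _

end Atoms

/-! ### Concrete functors as quantifier-free interpretations -/

theorem IsEmbeddingOf.relMap_iff {L : FirstOrder.Language.{u, v}} {V W : Type w}
    {A : L.Structure V} {B : L.Structure W} {f : V → W} (h : IsEmbeddingOf L A B f) {k : ℕ}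
    (R : L.Relations k) (x : Fin k → V) :
    B.RelMap R (fun j => f (x j)) ↔ A.RelMap R x := by
  obtain ⟨φ, rfl⟩ := h
  exact φ.map_rel' R x

namespace ConcreteFunctor

variable {σ : FirstOrder.Language.{u, v}} {τ : FirstOrder.Language.{u', v'}} {p q : ℕ}
  {C : HereditaryClass.{u, v, w} σ} {D : HereditaryClass.{u', v', w} τ}

/-- The relations of `F A` at a tuple are determined by the quantifier-free type of the tuple
in `A`. -/
theorem relMap_iff_of_holds_eq [σ.IsRelational] (F : ConcreteFunctor C D)
    (S : Fin p ≃ Σ k, σ.Relations k) {k : ℕ} (R : τ.Relations k)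
    {A : CategoryTheory.Bundled.{w} σ.Structure} (hA : A ∈ C.carrier)
    {B : CategoryTheory.Bundled.{w} σ.Structure} (hB : B ∈ C.carrier)
    {a : Fin k → A} {b : Fin k → B} (h : Atom.Holds S A.str a = Atom.Holds S B.str b) :
    (F.obj A hA).RelMap R a ↔ (F.obj B hB).RelMap R b := by
  have heq : ∀ i j, a i = a j ↔ b i = b j := fun i j => iff_of_eq (congrFun h (.inl (i, j)))
  have hrel : ∀ (s : Σ k, σ.Relations k) (g : Fin s.1 → Fin k),
      A.str.RelMap s.2 (fun j => a (g j)) ↔ B.str.RelMap s.2 (fun j => b (g j)) := by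
    intro s g
    obtain ⟨i, rfl⟩ := S.surjective s
    exact iff_of_eq (congrFun h (.inr ⟨i, g⟩))
  -- `c` picks an index for each vertex of the tuple; by `heq` the vertex `b (c x)` does not depend
  -- on the choice.
  choose c hc using fun x : Set.range a => x.2
  let str : σ.Structure (Set.range a) :=
    { funMap := fun f => isEmptyElim f
      RelMap := fun R x => A.str.RelMap R fun j => (x j).1 }
  let f : σ.Embedding (Set.range a) A :=
    { toFun := Subtype.val
      inj' := Subtype.val_injective
      map_fun' := fun f => isEmptyElim f
      map_rel' := fun _ _ => Iff.rfl }
  let g : σ.Embedding (Set.range a) B :=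
    { toFun := fun x => b (c x)
      inj' := fun x y hxy => Subtype.ext (by rw [← hc x, ← hc y]; exact (heq _ _).2 hxy)
      map_fun' := fun f => isEmptyElim f
      map_rel' := fun {m} R x => by
        refine (hrel ⟨m, R⟩ fun j => c (x j)).symm.trans (iff_of_eq ?_)
        exact congrArg (A.str.RelMap R) (funext fun j => hc (x j)) }
  let A₀ : CategoryTheory.Bundled.{w} σ.Structure := ⟨Set.range a, str⟩
  have hA₀ : A₀ ∈ C.carrier := C.closed A hA A₀ ⟨f⟩
  let a₀ : Fin k → A₀ := fun j => ⟨a j, j, rfl⟩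
  have h₁ := (F.map_embedding A₀ hA₀ A hA f).relMap_iff R a₀
  have h₂ := (F.map_embedding A₀ hA₀ B hB g).relMap_iff R a₀
  have hb : (fun j => g (a₀ j)) = b := funext fun j => (heq _ _).1 (hc (a₀ j))
  rw [hb] at h₂
  exact h₁.trans h₂.symm

open WordRAM Classical in
/-- Membership of a tuple in a relation of `F A` is the value of an expression. -/
theorem exists_expr [σ.IsRelational] (F : ConcreteFunctor C D) (S : Fin p ≃ Σ k, σ.Relations k)
    {k : ℕ} (R : τ.Relations k) :
    ∃ E : Expr, ∀ (A : CategoryTheory.Bundled.{w} σ.Structure) (hA : A ∈ C.carrier) (n : ℕ)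
      (e : Fin n ≃ A) (W : ℕ), 1 < W → n < W → (∀ j ≤ k, n ^ j < W) →
      (encodeStructure S A.str e).length ≤ W →
      ∀ (m : ℕ → ℕ) (i : Fin (n ^ k)), m 0 = i →
      E.eval W (encodeStructure S A.str e) m =
        if (F.obj A hA).RelMap R (fun j => e (finFunctionFinEquiv.symm i j)) then 1 else 0 := by
  -- A type is accepted if some tuple realising it, anywhere in the class, satisfies `R` under `F`;
  -- then all its realisations do.
  obtain ⟨E, hE⟩ := WordRAM.exists_expr (Atom.expr S (k := k)) fun v =>
    ∃ (B : CategoryTheory.Bundled.{w} σ.Structure) (hB : B ∈ C.carrier) (b : Fin k → B),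
      Atom.Holds S B.str b = v ∧ (F.obj B hB).RelMap R b
  refine ⟨E, fun A hA n e W hW hn hk hlen m i hm => ?_⟩
  rw [hE W _ m (Atom.Holds S A.str fun j => e (finFunctionFinEquiv.symm i j)) hW
    (Atom.eval_expr S A.str e hW hn hk hlen i hm)]
  refine if_congr ⟨?_, fun h => ⟨A, hA, _, rfl, h⟩⟩ rfl rfl
  rintro ⟨B, hB, b, hb, hR⟩
  exact (F.relMap_iff_of_holds_eq S R hB hA hb).1 hR

/-- A concrete functor is computed in time `K * n ^ r + K`, where `r` is the largest arity of a
relation symbol of the target signature. -/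
theorem exists_computableInTime [σ.IsRelational] (F : ConcreteFunctor C D)
    (Sσ : Fin p ≃ Σ k, σ.Relations k) (Sτ : Fin q ≃ Σ k, τ.Relations k) :
    ∃ K : ℕ, F.ComputableInTime Sσ Sτ fun n => K * n ^ maxArity Sτ + K := by
  classical
  choose E hE using fun R : Σ k, τ.Relations k => F.exists_expr Sσ R.2
  obtain ⟨K, hK⟩ := WordRAM.exec_tables (fun R : Σ k, τ.Relations k => R.1) E (maxArity Sτ)
    (List.ofFn Sτ) fun R hR => le_maxArity Sτ hR
  -- The first two summands cover the input length, the third the table sizes; the 2 gives `n < W`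
  -- even if all arities are 0.
  let c := p + maxArity Sσ + maxArity Sτ + 2
  refine ⟨K + (WordRAM.Expr.size.cost + 1),
    .seq (.write .size) (.tables ((List.ofFn Sτ).map fun R => (R.1, E R))), c,
    fun A hA n e => ?_⟩
  have hW : 1 < WordRAM.modulus c n := by
    simpa using WordRAM.pow_lt_modulus (k := 0) (c := c) n (by omega)
  have hn : n < WordRAM.modulus c n := by
    simpa using WordRAM.pow_lt_modulus (k := 1) (c := c) n (by omega)
  have hpow : ∀ R ∈ List.ofFn Sτ, ∀ j ≤ R.1, n ^ j < WordRAM.modulus c n := fun R hR j hj =>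
    WordRAM.pow_lt_modulus n (by have := le_maxArity Sτ hR; omega)
  have hlen : (encodeStructure Sσ A.str e).length ≤ WordRAM.modulus c n :=
    (length_encodeStructure_le Sσ A.str e).trans (WordRAM.succ_mul_pow_le_modulus n (by omega))
  have hx : (encodeStructure Sσ A.str e).getD 0 0 = n := rfl
  obtain ⟨t, m, ht, hex⟩ := hK (WordRAM.modulus c n) (encodeStructure Sσ A.str e) n
    (fun R i => if h : i < n ^ R.1 then
      if (F.obj A hA).RelMap R.2 (fun j => e (finFunctionFinEquiv.symm ⟨i, h⟩ j)) then 1 else 0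
      else 0)
    hW hx (fun R hR => hpow R hR _ le_rfl)
    (fun R hR m i hm hi => by
      rw [dif_pos hi]
      exact hE R A hA n e _ hW hn (hpow R hR) hlen m ⟨i, hi⟩ hm)
    ⟨fun _ => 0, [n]⟩
  have hw := WordRAM.Exec.write (W := WordRAM.modulus c n) (x := encodeStructure Sσ A.str e)
    .size .init
  rw [WordRAM.Expr.eval_size hx, Nat.mod_eq_of_lt hn] at hw
  refine ⟨WordRAM.Expr.size.cost + 1 + t, m, ?_, ?_⟩
  rotate_left
  · convert hw.seq hex using 2
    simp [encodeStructure]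
  · dsimp only
    rw [add_mul]
    omega

end ConcreteFunctor

theorem mainTheorem5 {σ : FirstOrder.Language.{u, v}} {τ : FirstOrder.Language.{u', v'}}
    [σ.IsRelational] [τ.IsRelational]
    {p q : ℕ} (Sσ : Fin p ≃ Σ k, σ.Relations k) (Sτ : Fin q ≃ Σ k, τ.Relations k) :
    (∀ (C : HereditaryClass.{u, v, w} σ) (D : HereditaryClass.{u', v', w} τ)
      (F : ConcreteFunctor C D), F.ComputableInPolyTime Sσ Sτ) ∧
    (∀ F : ConcreteFunctor (HereditaryClass.all.{u, v, w} σ) (HereditaryClass.all.{u', v', w} τ),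
      ∃ T : ℕ → ℕ, F.ComputableInTime Sσ Sτ T ∧
        (fun n => (T n : ℝ)) =O[Filter.atTop] fun n : ℕ => (n : ℝ) ^ maxArity Sτ) := by
  refine ⟨fun C D F => ?_, fun F => ?_⟩
  · obtain ⟨K, hK⟩ := F.exists_computableInTime Sσ Sτ
    refine ⟨.C K * .X ^ maxArity Sτ + .C K, ?_⟩
    simpa using hK
  · obtain ⟨K, hK⟩ := F.exists_computableInTime Sσ Sτ
    -- For `n ≥ 1` the additive `K` is at most `K * n ^ r`.
    refine ⟨_, hK, Asymptotics.IsBigO.of_bound (2 * K) ?_⟩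
    filter_upwards [Filter.eventually_ge_atTop 1] with n hn
    have h1 : (1 : ℝ) ≤ (n : ℝ) ^ maxArity Sτ := one_le_pow₀ (by exact_mod_cast hn)
    rw [Real.norm_of_nonneg (by positivity), Real.norm_of_nonneg (by positivity)]
    push_cast
    nlinarith [(Nat.cast_nonneg K : (0 : ℝ) ≤ K)]
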